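/- For finite simple graphs $\mathcal G,\mathcal F$ with the same number of vertices, let $\operatorname{FS}(\mathcal G,\mathcal F)$ be the graph whose vertices are the bijections $\sigma: V(\mathcal G)\to V(\mathcal F)$, where $\sigma,\sigma'$ are adjacent if and only if there is an edge $\{A,B\}$ of $\mathcal G$ such that $\{\sigma(A),\sigma(B)\}$ is an edge of $\mathcal F$, $\sigma(A)=\sigma'(B)$, $\sigma(B)=\sigma'(A)$, and $\sigma(C)=\sigma'(C)$ for all $C\in V(\mathcal G)\setminus\{A,B\}$. For $0\le k\le n$, let $\mathcal B^{(k)}_{n-k}$ be the $k$-book graph on $n$ vertices: $n-k$ copies of the complete graph $\mathcal K_{k+1}$ joined along a common $\mathcal K_k$ (so $\mathcal B^{(n)}_{0}=\mathcal K_n$). A graph is called biconnected if it is connected and has no cut-vertex, i.e. no vertex whose removal increases the number of connected components (a single vertex and a single edge are allowed). **Balloon Lemma.** Let $\mathcal G$ be a biconnected graph on $n-1$ vertices, let $P$ be a vertex of $\mathcal G$, and let $\mathcal Q$ be the graph on $n$ vertices obtained from $\mathcal G$ by adding a new vertex $O$ adjacent to $P$ and to no other vertex. Then $\operatorname{FS}(\mathcal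 Q,\mathcal B^{(k)}_{n-k})$ is connected for every integer $k$ with $2\le k\le n$. -/

import Mathlib

namespace SimpleGraph

/-- The friends-and-strangers graph `FS(G, F)`. Its vertices, the configurations, are the bijections
from the vertices of `G` (positions) to the vertices of `F` (people). Two configurations are adjacent
when they differ by swapping two friends who stand on the two ends of an edge of `G`. -/
def friendsStrangers {V U : Type*} (G : SimpleGraph V) (F : SimpleGraph U) :
    SimpleGraph (V ≃ U) where
  Adj σ τ := ∃ A B : V, G.Adj A B ∧ F.Adj (σ A) (σ B) ∧ σ A = τ B ∧ σ B = τ A ∧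
    ∀ C : V, C ≠ A → C ≠ B → σ C = τ C
  symm := ⟨by
    rintro σ τ ⟨A, B, hG, hF, h1, h2, h3⟩
    exact ⟨A, B, hG, by rw [← h1, ← h2]; exact hF.symm, h2.symm, h1.symm,
      fun C hA hB => (h3 C hA hB).symm⟩⟩
  loopless := ⟨by
    rintro σ ⟨A, B, hG, -, h1, -, -⟩
    exact hG.ne (σ.injective h1)⟩

/-- The book graph `B_m^(k)` with `m` pages, on `k + m` vertices: `m` copies of the complete graph on
`k + 1` vertices, joined along a common complete graph on `k` vertices. The vertices `Sum.inl i` form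
the common complete graph (the spine), and `Sum.inr j` is the remaining vertex of the `j`-th copy.
For `m = 0` this is the complete graph on `k` vertices. -/
def bookGraph (k m : ℕ) : SimpleGraph (Fin k ⊕ Fin m) where
  Adj x y := match x, y with
    | Sum.inl i, Sum.inl j => i ≠ j
    | Sum.inl _, Sum.inr _ => True
    | Sum.inr _, Sum.inl _ => True
    | Sum.inr _, Sum.inr _ => False
  symm := ⟨by
    rintro (i | i) (j | j) h
    · exact Ne.symm h
    · trivial
    · trivial
    · exact h⟩
  loopless := ⟨by
    rintro (i | i) h
    · exact h rfl
    · exact h⟩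

/-- `v` is a cut-vertex of `G`: removing it increases the number of connected components. -/
def IsCutVertex {V : Type*} (G : SimpleGraph V) (v : V) : Prop :=
  ENat.card G.ConnectedComponent < ENat.card (G.induce {v}ᶜ).ConnectedComponent

/-- A graph is biconnected if it is connected and has no cut-vertex. A single vertex and a
single edge are allowed. -/
def IsBiconnected {V : Type*} (G : SimpleGraph V) : Prop :=
  G.Connected ∧ ∀ v : V, ¬ G.IsCutVertex v

/-- The graph obtained from `G` by adding one new vertex `none`, whose only neighbour is the
vertex `P` of `G`. -/
def addLeaf {V : Type*} (G : SimpleGraph V) (P : V) : SimpleGraph (Option V) where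
  Adj x y := match x, y with
    | some a, some b => G.Adj a b
    | some a, none => a = P
    | none, some b => b = P
    | none, none => False
  symm := ⟨by
    rintro (_ | a) (_ | b) h
    · exact h
    · exact h
    · exact h
    · exact G.adj_symm h⟩
  loopless := ⟨by
    rintro (_ | a) h
    · exact h
    · exact G.loopless.irrefl a h⟩

end SimpleGraph

/-! Since k ≥ 2, two spine people a and b are friends of everybody; it is enough to use only the
friendships involving one of them (`hubGraph`). A hub can walk anywhere. As G has no cut-vertex, a
hub can also get round any person, and so push that person along any path in G
(`IsHub.exists_move`). Hence any two non-hubs s and t can be gathered with a and b on a claw centred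
at P, one of whose leaves is O, and a few swaps there exchange s and t. Exchanging s and t is an
automorphism of `hubGraph`, so the gathering moves can be undone with the two relabelled: every
transposition of non-hubs is achieved from every configuration. Once the hubs are parked at O and P,
any two configurations differ by a product of such transpositions. -/

namespace SimpleGraph

/-! ### Moves available to hubs -/

section FriendsStrangers

variable {V U : Type*} {Q : SimpleGraph V} {F : SimpleGraph U}

/-- Isomorphic pairs of graphs have isomorphic friends-and-strangers graphs. -/
def friendsStrangersCongr {V' U' : Type*} {Q' : SimpleGraph V'} {F' : SimpleGraph U'}
    (e : Q ≃g Q') (f : F ≃g F') :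
    Q.friendsStrangers F ≃g Q'.friendsStrangers F' where
  toEquiv := Equiv.equivCongr e.toEquiv f.toEquiv
  map_rel_iff' := by
    intro σ τ
    have he (x) : e.toEquiv.symm (e x) = x := e.toEquiv.symm_apply_apply x
    have hσ (ρ : V ≃ U) (x) : Equiv.equivCongr e.toEquiv f.toEquiv ρ (e x) = f (ρ x) :=
      congrArg (fun y => f (ρ y)) (he x)
    constructor
    · rintro ⟨A, B, hQ, hF, h1, h2, h3⟩
      obtain ⟨A, rfl⟩ := e.surjective A
      obtain ⟨B, rfl⟩ := e.surjective B
      rw [hσ, hσ] at hF h1 h2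
      refine ⟨A, B, e.map_adj_iff.1 hQ, f.map_adj_iff.1 hF, f.injective h1, f.injective h2,
        fun C hA hB => f.injective ?_⟩
      rw [← hσ, ← hσ]
      exact h3 (e C) (e.injective.ne hA) (e.injective.ne hB)
    · rintro ⟨A, B, hQ, hF, h1, h2, h3⟩
      refine ⟨e A, e B, e.map_adj_iff.2 hQ, ?_, ?_, ?_, fun C hA hB => ?_⟩
      · rw [hσ, hσ]; exact f.map_adj_iff.2 hF
      · rw [hσ, hσ, h1]
      · rw [hσ, hσ, h2]
      · obtain ⟨C, rfl⟩ := e.surjective C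
        rw [hσ, hσ, h3 C (fun h => hA (h ▸ rfl)) (fun h => hB (h ▸ rfl))]

lemma friendsStrangers_mono_right {F' : SimpleGraph U} (h : F ≤ F') :
    Q.friendsStrangers F ≤ Q.friendsStrangers F' := by
  rintro σ τ ⟨A, B, hQ, hF, hr⟩
  exact ⟨A, B, hQ, h hF, hr⟩

/-- A sequence of moves stays legal when the people are relabelled by an automorphism of `F`. -/
lemma friendsStrangers_reachable_trans_iso (f : F ≃g F) {σ τ : V ≃ U}
    (h : (Q.friendsStrangers F).Reachable σ τ) :
    (Q.friendsStrangers F).Reachable (σ.trans f.toEquiv) (τ.trans f.toEquiv) :=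
  h.map (friendsStrangersCongr (Iso.refl (G := Q)) f).toHom

/-- A person who is a friend of everybody else. -/
def IsHub (F : SimpleGraph U) (x : U) : Prop := ∀ y, x ≠ y → F.Adj x y

open Classical in
lemma friendsStrangers_adj_swap {σ : V ≃ U} {A B : V} (hQ : Q.Adj A B)
    (hF : F.Adj (σ A) (σ B)) :
    (Q.friendsStrangers F).Adj σ ((Equiv.swap A B).trans σ) :=
  ⟨A, B, hQ, hF, by simp, by simp, fun C hA hB => by
    simp [Equiv.swap_apply_of_ne_of_ne hA hB]⟩

/-- A hub can swap places with any neighbour. -/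
lemma IsHub.exists_swap {x : U} (hx : F.IsHub x) {σ : V ≃ U} {A B : V} (hQ : Q.Adj A B)
    (hA : σ A = x) : ∃ τ, (Q.friendsStrangers F).Reachable σ τ ∧ τ A = σ B ∧ τ B = x ∧
      ∀ C, C ≠ A → C ≠ B → τ C = σ C := by
  classical
  refine ⟨_, (friendsStrangers_adj_swap hQ ?_).reachable, by simp, by simpa using hA,
    fun C h1 h2 => by simp [Equiv.swap_apply_of_ne_of_ne h1 h2]⟩
  rw [hA]
  exact hx _ (fun h => hQ.ne (σ.injective (hA.trans h)))

/-- A hub can walk to any place within a connected set of positions. -/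
lemma IsHub.exists_walk {x : U} (hx : F.IsHub x) {S : Set V} {p q : S}
    (h : (Q.induce S).Reachable p q) {σ : V ≃ U} (hp : σ p = x) :
    ∃ τ, (Q.friendsStrangers F).Reachable σ τ ∧ τ q = x ∧ ∀ v, v ∉ S → τ v = σ v := by
  obtain ⟨w⟩ := h
  induction w generalizing σ with
  | nil => exact ⟨σ, .rfl, hp, fun _ _ => rfl⟩
  | @cons u v w huv _ ih =>
    obtain ⟨σ', hr, -, hv, hfix⟩ := hx.exists_swap (Q := Q) huv hp
    obtain ⟨τ, hr', hq, hfix'⟩ := ih hv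
    refine ⟨τ, hr.trans hr', hq, fun C hC => (hfix' C hC).trans (hfix C ?_ ?_)⟩
    · rintro rfl; exact hC u.2
    · rintro rfl; exact hC v.2

/-- A hub can walk within a connected set of positions up to a neighbour of a given position,
without disturbing the person who stands there. -/
lemma IsHub.exists_walk_to_neighbor {x : U} (hx : F.IsHub x) {S : Set V} {p q : S}
    (h : (Q.induce S).Reachable p q) {σ : V ≃ U} (hp : σ p = x) (hpq : p ≠ q) :
    ∃ τ, (Q.friendsStrangers F).Reachable σ τ ∧ τ q = σ q ∧
      (∃ r ∈ S, Q.Adj q r ∧ τ r = x) ∧ ∀ v, v ∉ S → τ v = σ v := by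
  obtain ⟨w⟩ := h
  induction w generalizing σ with
  | nil => exact absurd rfl hpq
  | @cons u v q huv _ ih =>
    by_cases hvq : v = q
    · subst hvq
      exact ⟨σ, .rfl, rfl, ⟨u, u.2, Adj.symm huv, hp⟩, fun _ _ => rfl⟩
    obtain ⟨σ', hr, -, hv, hfix⟩ := hx.exists_swap (Q := Q) huv hp
    obtain ⟨τ, hr', hq, hnb, hfix'⟩ := ih hv hvq
    refine ⟨τ, hr.trans hr', hq.trans (hfix q ?_ ?_), hnb,
      fun C hC => (hfix' C hC).trans (hfix C ?_ ?_)⟩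
    · exact fun h => hpq (Subtype.ext h.symm)
    · exact fun h => hvq (Subtype.ext h.symm)
    · rintro rfl; exact hC u.2
    · rintro rfl; exact hC v.2

/-- Two hubs at the centre and at a leaf of a claw allow the persons on the other two leaves to be
exchanged. -/
lemma friendsStrangers_reachable_of_claw [DecidableEq U] {a b s t : U} (ha : F.IsHub a)
    (hb : F.IsHub b) {σ : V ≃ U} {O P L R : V} (hO : Q.Adj P O) (hL : Q.Adj P L)
    (hR : Q.Adj P R) (sO : σ O = s) (sP : σ P = a) (sL : σ L = t) (sR : σ R = b)
    (hOL : O ≠ L) (hOR : O ≠ R) (hLR : L ≠ R) :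
    (Q.friendsStrangers F).Reachable σ (σ.trans (Equiv.swap s t)) := by
  -- The occupants of (O, P, L, R) run through satb, stab, sbat, bsat, bast, btsa, tbsa, tasb.
  obtain ⟨σ₁, r₁, p₁, q₁, f₁⟩ := ha.exists_swap hL sP
  obtain ⟨σ₂, r₂, p₂, q₂, f₂⟩ := hb.exists_swap (σ := σ₁) hR.symm
    (by rw [f₁ _ hR.ne' hLR.symm, sR])
  obtain ⟨σ₃, r₃, p₃, q₃, f₃⟩ := hb.exists_swap hO q₂
  obtain ⟨σ₄, r₄, p₄, q₄, f₄⟩ := ha.exists_swap (σ := σ₃) hL.symm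
    (by rw [f₃ _ hL.ne' hOL.symm, f₂ _ hLR hL.ne', q₁])
  obtain ⟨σ₅, r₅, p₅, q₅, f₅⟩ := ha.exists_swap hR q₄
  obtain ⟨σ₆, r₆, p₆, q₆, f₆⟩ := hb.exists_swap (σ := σ₅) hO.symm
    (by rw [f₅ _ hO.ne' hOR, f₄ _ hOL hO.ne', q₃])
  obtain ⟨σ₇, r₇, p₇, q₇, f₇⟩ := hb.exists_swap hR q₆
  have e : σ₇ = σ.trans (Equiv.swap s t) := by
    have := hO.ne; have := hL.ne; have := hR.ne
    have hinj := σ.injective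
    ext v
    rw [Equiv.trans_apply, Equiv.swap_apply_def]
    by_cases hvO : v = O
    · subst hvO; grind
    by_cases hvL : v = L
    · subst hvL; grind
    have hs : σ v ≠ s := fun h => hvO (hinj (h.trans sO.symm))
    have ht : σ v ≠ t := fun h => hvL (hinj (h.trans sL.symm))
    rw [if_neg hs, if_neg ht]
    by_cases hvP : v = P
    · subst hvP; grind
    by_cases hvR : v = R
    · subst hvR; grind
    grind
  exact e ▸ r₁.trans (r₂.trans (r₃.trans (r₄.trans (r₅.trans (r₆.trans r₇)))))

end FriendsStrangers

/-! ### Friendships involving two hubs only -/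

section Hubs

variable {U : Type*}

/-- The graph in which `a` and `b` are friends of everybody and there are no other friendships. -/
def hubGraph (a b : U) : SimpleGraph U where
  Adj x y := x ≠ y ∧ (x = a ∨ x = b ∨ y = a ∨ y = b)
  symm := ⟨fun _ _ h => ⟨h.1.symm, by tauto⟩⟩
  loopless := ⟨fun _ h => h.1 rfl⟩

lemma isHub_hubGraph_left (a b : U) : (hubGraph a b).IsHub a := fun _ h => ⟨h, .inl rfl⟩

lemma isHub_hubGraph_right (a b : U) : (hubGraph a b).IsHub b := fun _ h => ⟨h, .inr (.inl rfl)⟩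

lemma hubGraph_le {F : SimpleGraph U} {a b : U} (ha : F.IsHub a) (hb : F.IsHub b) :
    hubGraph a b ≤ F := by
  rintro x y ⟨hne, rfl | rfl | rfl | rfl⟩
  · exact ha _ hne
  · exact hb _ hne
  · exact (ha _ hne.symm).symm
  · exact (hb _ hne.symm).symm

/-- A permutation that fixes both hubs is an automorphism of the hub graph. -/
def hubGraphIso {a b : U} (π : Equiv.Perm U) (ha : π a = a) (hb : π b = b) :
    hubGraph a b ≃g hubGraph a b where
  toEquiv := π
  map_rel_iff' := by
    have ha' (x) : π x = a ↔ x = a := by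
      conv_lhs => rw [← ha, π.injective.eq_iff]
    have hb' (x) : π x = b ↔ x = b := by
      conv_lhs => rw [← hb, π.injective.eq_iff]
    intro x y
    simp only [hubGraph, ha', hb', ne_eq, π.injective.eq_iff]

end Hubs

/-! ### A biconnected graph with a leaf attached -/

section Leaf

variable {W U : Type*} {G : SimpleGraph W} {P : W} {F : SimpleGraph U}

/-- Only `Preconnected`, since nothing is left when `v` is the sole vertex. -/
lemma IsBiconnected.preconnected_induce (hG : G.IsBiconnected) (v : W) :
    (G.induce {v}ᶜ).Preconnected := by
  have h1 : ENat.card G.ConnectedComponent ≤ 1 := by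
    have := hG.1.preconnected.subsingleton_connectedComponent
    exact (ENat.card_le_one_iff_subsingleton _).2 this
  have h2 : ENat.card (G.induce {v}ᶜ).ConnectedComponent ≤ 1 := (not_lt.1 (hG.2 v)).trans h1
  have := (ENat.card_le_one_iff_subsingleton _).1 h2
  exact fun x y => ConnectedComponent.exact (Subsingleton.elim _ _)

/-- Confines a hub's walk to `S`, so that the occupants of the leaf and of the places outside `S`
stay put. -/
lemma addLeaf_induce_reachable {S : Set W} {x y : S} (h : (G.induce S).Reachable x y) :
    ((G.addLeaf P).induce (some '' S)).Reachable ⟨some x, x, x.2, rfl⟩ ⟨some y, y, y.2, rfl⟩ :=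
  h.map (G := G.induce S) (G' := (G.addLeaf P).induce (some '' S))
    ⟨fun z => ⟨some z, z, z.2, rfl⟩, fun h => h⟩

lemma induce_univ_reachable (hG : G.Preconnected) (x y : (Set.univ : Set W)) :
    (G.induce Set.univ).Reachable x y :=
  (hG x y).map (G' := G.induce Set.univ) ⟨fun z => ⟨z, trivial⟩, fun h => h⟩

lemma addLeaf_preconnected (hG : G.Preconnected) : (G.addLeaf P).Preconnected := by
  have key (x) : (G.addLeaf P).Reachable x (some P) := by
    cases x with
    | none => exact Adj.reachable (G := G.addLeaf P) (u := none) (v := some P) rfl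
    | some x => exact (hG x P).map (G' := G.addLeaf P) ⟨some, fun h => h⟩
  exact fun x y => (key x).trans (key y).symm

lemma exists_position (σ : Option W ≃ U) {x : U} (h : σ none ≠ x) : ∃ u, σ (some u) = x := by
  obtain ⟨v, rfl⟩ := σ.surjective x
  cases v with
  | none => exact absurd rfl h
  | some u => exact ⟨u, rfl⟩

/-- One hub among the positions of a biconnected graph allows any person to be moved anywhere. -/
lemma IsHub.exists_move (hG : G.IsBiconnected) {x t : U} (hx : F.IsHub x) (hxt : x ≠ t)
    {σ : Option W ≃ U} (hxσ : σ none ≠ x) {v v' : W} (ht : σ (some v) = t) :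
    ∃ τ, ((G.addLeaf P).friendsStrangers F).Reachable σ τ ∧ τ none = σ none ∧
      τ (some v') = t := by
  obtain ⟨w⟩ := hG.1.preconnected v v'
  induction w generalizing σ with
  | nil => exact ⟨σ, .rfl, rfl, ht⟩
  | @cons v w _ hvw _ ih =>
    obtain ⟨u, hu⟩ := exists_position σ hxσ
    have huv : u ≠ v := by rintro rfl; exact hxt (hu.symm.trans ht)
    -- The hub goes round `v` to `w`, the next place on the path of `t`, and then swaps with `t`.
    obtain ⟨σ₁, r₁, h₁, f₁⟩ := hx.exists_walk (addLeaf_induce_reachable (P := P)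
      (hG.preconnected_induce v ⟨u, huv⟩ ⟨w, hvw.ne'⟩)) hu
    obtain ⟨σ₂, r₂, h₂, -, f₂⟩ := hx.exists_swap (Q := G.addLeaf P) (A := some w) (B := some v)
      hvw.symm h₁
    have e₁ : σ₁ none = σ none := f₁ _ (by simp)
    have e₂ : σ₂ none = σ₁ none := f₂ _ (by simp) (by simp)
    obtain ⟨τ, r, e, h⟩ := ih (σ := σ₂) (by rwa [e₂, e₁])
      (by rw [h₂, f₁ _ (by simp), ht])
    exact ⟨τ, r₁.trans (r₂.trans r), by rw [e, e₂, e₁], h⟩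

/-- In a biconnected graph with a leaf attached, any two persons other than the two hubs can be
exchanged after suitable moves: bring them to two leaves of a claw whose centre and third leaf are
taken by the hubs. -/
lemma exists_reachable_swap [DecidableEq U] (hG : G.IsBiconnected) {a b s t : U}
    (ha : F.IsHub a) (hb : F.IsHub b) (hab : a ≠ b) (hsa : s ≠ a) (hsb : s ≠ b) (hta : t ≠ a)
    (htb : t ≠ b) (hst : s ≠ t) (σ : Option W ≃ U) :
    ∃ τ, ((G.addLeaf P).friendsStrangers F).Reachable σ τ ∧
      ((G.addLeaf P).friendsStrangers F).Reachable τ (τ.trans (Equiv.swap s t)) := by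
  -- `a` waits at the leaf while `b` brings `s` to `P`; swapping `a` with `s` then puts `s` on the
  -- leaf.
  obtain ⟨σ₁, r₁, h₁, -⟩ := ha.exists_walk (q := ⟨none, Set.mem_univ _⟩)
    (induce_univ_reachable (addLeaf_preconnected (P := P) hG.1.preconnected)
      ⟨σ.symm a, trivial⟩ _) (σ := σ) (by simp)
  obtain ⟨v, hv⟩ := exists_position σ₁ (x := s) (by rw [h₁]; exact hsa.symm)
  obtain ⟨σ₂, r₂, e₂, h₂⟩ := hb.exists_move (P := P) hG hsb.symm (σ := σ₁) (v' := P)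
    (by rwa [h₁]) hv
  rw [h₁] at e₂
  obtain ⟨σ₃, r₃, h₃, h₃', -⟩ := ha.exists_swap (Q := G.addLeaf P) (A := none) (B := some P)
    (σ := σ₂) rfl e₂
  rw [h₂] at h₃
  obtain ⟨u, hu⟩ := exists_position σ₃ (x := b) (by rwa [h₃])
  obtain ⟨w, hw⟩ := exists_position σ₃ (x := t) (by rwa [h₃])
  have huP : u ≠ P := by rintro rfl; exact hab (h₃'.symm.trans hu)
  have : Nontrivial W := ⟨u, P, huP⟩
  obtain ⟨L, hL⟩ := hG.1.preconnected.exists_adj_of_nontrivial P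
  obtain ⟨σ₄, r₄, e₄, h₄⟩ := hb.exists_move (P := P) hG htb.symm (σ := σ₃) (v' := L)
    (by rwa [h₃]) hw
  rw [h₃] at e₄
  obtain ⟨p, hp⟩ := exists_position σ₄ (x := a) (by rwa [e₄])
  have hpL : p ≠ L := by rintro rfl; exact hta (h₄.symm.trans hp)
  -- From here both hubs walk in G - L, which keeps `t` at `L` and `s` at the leaf.
  obtain ⟨σ₅, r₅, h₅, f₅⟩ := ha.exists_walk (addLeaf_induce_reachable (P := P)
    (hG.preconnected_induce L ⟨p, hpL⟩ ⟨P, hL.ne⟩)) hp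
  have e₅ : σ₅ none = s := by rw [f₅ _ (by simp), e₄]
  have l₅ : σ₅ (some L) = t := by rw [f₅ _ (by simp), h₄]
  obtain ⟨q, hq⟩ := exists_position σ₅ (x := b) (by rwa [e₅])
  have hqL : q ≠ L := by rintro rfl; exact htb (l₅.symm.trans hq)
  have hqP : q ≠ P := by rintro rfl; exact hab (h₅.symm.trans hq)
  -- `b` stops just before entering `P`; its place `R` differs from `L` because the walk avoids `L`,
  -- and is the third leaf of the claw.
  obtain ⟨σ₆, r₆, h₆, ⟨_, ⟨R, hRL, rfl⟩, hPR, hR⟩, f₆⟩ :=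
    hb.exists_walk_to_neighbor (addLeaf_induce_reachable (P := P)
      (hG.preconnected_induce L ⟨q, hqL⟩ ⟨P, hL.ne⟩)) hq
      (fun h => hqP (Option.some_injective _ (congrArg Subtype.val h)))
  refine ⟨σ₆, r₁.trans (r₂.trans (r₃.trans (r₄.trans (r₅.trans r₆)))), ?_⟩
  exact friendsStrangers_reachable_of_claw ha hb (O := none) (P := some P) (L := some L)
    (R := some R) rfl hL hPR (by rw [f₆ _ (by simp), e₅]) (h₆.trans h₅)
    (by rw [f₆ _ (by simp), l₅]) hR (by simp) (by simp) (by simpa using Ne.symm hRL)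

/-- The hubs can be brought to the leaf and to its neighbour. -/
lemma exists_reachable_hubs (hG : G.Connected) {a b : U} (ha : F.IsHub a) (hb : F.IsHub b)
    (hab : a ≠ b) (σ : Option W ≃ U) :
    ∃ τ, ((G.addLeaf P).friendsStrangers F).Reachable σ τ ∧ τ none = a ∧ τ (some P) = b := by
  obtain ⟨σ₁, r₁, h₁, -⟩ := ha.exists_walk (q := ⟨none, Set.mem_univ _⟩)
    (induce_univ_reachable (addLeaf_preconnected (P := P) hG.preconnected)
      ⟨σ.symm a, trivial⟩ _) (σ := σ) (by simp)
  obtain ⟨v, hv⟩ := exists_position σ₁ (x := b) (by rwa [h₁])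
  obtain ⟨σ₂, r₂, h₂, f₂⟩ := hb.exists_walk (addLeaf_induce_reachable (P := P)
    (induce_univ_reachable hG.preconnected ⟨v, trivial⟩ ⟨P, trivial⟩)) hv
  exact ⟨σ₂, r₁.trans r₂, by rw [f₂ _ (by simp), h₁], h₂⟩

/-- Conjugation: gather, exchange `s` and `t` on the claw, then reverse the gathering with `s` and
`t` relabelled. This is why `hubGraph` is used: in a book graph, exchanging a spine vertex with a
page vertex is in general not an automorphism. -/
lemma friendsStrangers_hubGraph_reachable_swap [DecidableEq U] (hG : G.IsBiconnected)
    {a b s t : U} (hab : a ≠ b) (hsa : s ≠ a) (hsb : s ≠ b) (hta : t ≠ a) (htb : t ≠ b)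
    (hst : s ≠ t) (σ : Option W ≃ U) :
    ((G.addLeaf P).friendsStrangers (hubGraph a b)).Reachable σ
      (σ.trans (Equiv.swap s t)) := by
  obtain ⟨τ, r, r'⟩ := exists_reachable_swap (P := P) hG (isHub_hubGraph_left a b)
    (isHub_hubGraph_right a b) hab hsa hsb hta htb hst σ
  exact r.trans (r'.trans (friendsStrangers_reachable_trans_iso
    (hubGraphIso (Equiv.swap s t) (Equiv.swap_apply_of_ne_of_ne hsa.symm hta.symm)
      (Equiv.swap_apply_of_ne_of_ne hsb.symm htb.symm)) r.symm))

lemma friendsStrangers_hubGraph_preconnected [Finite U] (hG : G.IsBiconnected) {a b : U}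
    (hab : a ≠ b) : ((G.addLeaf P).friendsStrangers (hubGraph a b)).Preconnected := by
  classical
  have key (ρ : Equiv.Perm {x : U // x ≠ a ∧ x ≠ b}) : ∀ σ : Option W ≃ U,
      ((G.addLeaf P).friendsStrangers (hubGraph a b)).Reachable σ
        (σ.trans (Equiv.Perm.ofSubtype ρ)) := by
    induction ρ using Equiv.Perm.swap_induction_on with
    | one => intro σ; rw [map_one]; exact .rfl
    | swap_mul f x y hxy ih =>
      intro σ
      rw [map_mul, Equiv.Perm.ofSubtype_swap_eq]
      exact (ih σ).trans (friendsStrangers_hubGraph_reachable_swap hG hab x.2.1 x.2.2 y.2.1 y.2.2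
        (fun h => hxy (Subtype.ext h)) _)
  intro σ τ
  obtain ⟨σ', r, hO, hP⟩ := exists_reachable_hubs (P := P) hG.1 (isHub_hubGraph_left a b)
    (isHub_hubGraph_right a b) hab σ
  obtain ⟨τ', r', hO', hP'⟩ := exists_reachable_hubs (P := P) hG.1 (isHub_hubGraph_left a b)
    (isHub_hubGraph_right a b) hab τ
  -- Both configurations have the hubs in the same places, so `π` moves only non-hubs and `key`
  -- applies.
  set π : Equiv.Perm U := σ'.symm.trans τ' with hπ
  have hπa : π a = a := by simp [hπ, ← hO, hO']
  have hπb : π b = b := by simp [hπ, ← hP, hP']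
  have h₁ (x : U) : π x ≠ a ∧ π x ≠ b ↔ x ≠ a ∧ x ≠ b :=
    and_congr (by conv_lhs => rw [← hπa, π.injective.ne_iff])
      (by conv_lhs => rw [← hπb, π.injective.ne_iff])
  have h₂ (x : U) (hx : π x ≠ x) : x ≠ a ∧ x ≠ b :=
    ⟨by rintro rfl; exact hx hπa, by rintro rfl; exact hx hπb⟩
  have e := key (π.subtypePerm h₁) σ'
  rw [Equiv.Perm.ofSubtype_subtypePerm h₁ h₂] at e
  have e' : σ'.trans π = τ' := by ext; simp [hπ]
  rw [e'] at e
  exact r.trans (e.trans r'.symm)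

end Leaf

lemma isHub_bookGraph (k m : ℕ) (i : Fin k) : (bookGraph k m).IsHub (Sum.inl i) := by
  rintro (j | j) h
  · exact fun hij => h (congrArg _ hij)
  · trivial

end SimpleGraph

theorem mainTheorem4 {W V : Type*} [Fintype W] [Fintype V] (n : ℕ)
    (G : SimpleGraph W) (hn : Fintype.card W + 1 = n) (hG : G.IsBiconnected) (P : W)
    (Q : SimpleGraph V) (hQ : Nonempty (Q ≃g G.addLeaf P))
    (k : ℕ) (hk : 2 ≤ k) (hkn : k ≤ n) :
    (Q.friendsStrangers (SimpleGraph.bookGraph k (n - k))).Connected := by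
  obtain ⟨e⟩ := hQ
  rw [(SimpleGraph.friendsStrangersCongr e SimpleGraph.Iso.refl).connected_iff]
  let a : Fin k ⊕ Fin (n - k) := Sum.inl ⟨0, by omega⟩
  let b : Fin k ⊕ Fin (n - k) := Sum.inl ⟨1, by omega⟩
  have hab : a ≠ b := by simp [a, b]
  have : Nonempty (Option W ≃ Fin k ⊕ Fin (n - k)) :=
    ⟨Fintype.equivOfCardEq (by simp; omega)⟩
  exact ⟨(SimpleGraph.friendsStrangers_hubGraph_preconnected hG hab).mono
    (SimpleGraph.friendsStrangers_mono_right (SimpleGraph.hubGraph_le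
      (SimpleGraph.isHub_bookGraph _ _ _) (SimpleGraph.isHub_bookGraph _ _ _)))⟩
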